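/- Let $k$ be a field, $R=k[\![x_1,\dots,x_n]\!]$ with maximal ideal $\mathfrak m$, and let $\Gamma=k_{DP}[X_1,\dots,X_n]$ be the $k$-vector space with basis the divided power monomials $X^{[M]}$, $M\in\mathbb N^n$, regarded as an $R$-module by contraction: $\left(\sum_N a_N x^N\right)\circ\left(\sum_M b_M X^{[M]}\right)=\sum_{N\le M} a_N b_M X^{[M-N]}$. For an ideal $J\subseteq R$ put $J^\perp=\{g\in\Gamma : f\circ g=0 \text{ for all } f\in J\}$. Let $I\subsetneq R$ be an ideal such that $A=R/I$ is Gorenstein (that is, Cohen–Macaulay of type one) of dimension $d$, and let $z=(z_1,\dots,z_d)$ be a regular linear sequence for $A$: $z_1,\dots,z_d$ are part of a minimal system of generators of $\mathfrak m$, and their cosets form a system of parameters of $A$. For $L=(l_1,\dots,l_d)\in\mathbb N_+^d$ put $W_L=(I+(z_1^{l_1},\dots,z_d^{l_d}))^\perp$, let $\gamma_i$ be the $i$-th coordinate vector, and let $\mathbf 1_d=(1,\dots,1)$. (1) Let $L\in\mathbb N_+^d$, and for every $i$ with $l_i\ge 2$ let $H_{L-\gamma_i}$ be a generator of the $R$-module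 $W_{L-\gamma_i}$, such that $z_j\circ H_{L-\gamma_i}=z_i\circ H_{L-\gamma_j}$ for all $i,j$ with $l_i,l_j\ge 2$. Then there exists a generator $H_L$ of the (cyclic) $R$-module $W_L$ such that $z_i\circ H_L=H_{L-\gamma_i}$ for all $i$ with $l_i\ge 2$. (2) Consequently, for every generator $H$ of $W_{\mathbf 1_d}=(I+(z_1,\dots,z_d))^\perp$ there is a family $(H_L)_{L\in\mathbb N_+^d}$ in $\Gamma$ with $H_{\mathbf 1_d}=H$ such that, for every $L\in\mathbb N_+^d$, $H_L$ generates $W_L$ and $z_i\circ H_L=H_{L-\gamma_i}$ for all $i$ with $l_i\ge 2$. -/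

import Mathlib

namespace InverseSystem

/-! ### Gorenstein local rings -/

/-- The socle of a module `M` over a local ring `(A, 𝔪)`: the elements of `M` killed by `𝔪`. It is
a vector space over the residue field `A ⧸ 𝔪`. -/
abbrev socle (A : Type*) [CommRing A] [IsLocalRing A] (M : Type*) [AddCommGroup M] [Module A M] :
    Submodule A M :=
  Submodule.torsionBySet A M (IsLocalRing.maximalIdeal A : Set A)

/-- A local ring `(A, 𝔪)` is Gorenstein if it is Noetherian, Cohen-Macaulay and of type one: some
sequence `rs` of `dim A` elements of `𝔪` is regular on `A`, and the socle of the Artinian reduction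
`A ⧸ (rs)` is one-dimensional over the residue field. For an Artinian local ring (`rs` is empty)
this says that the socle of `A` is one-dimensional. -/
structure IsGorensteinLocalRing (A : Type*) [CommRing A] [IsLocalRing A] : Prop where
  noetherian : IsNoetherianRing A
  exists_regular : ∃ rs : List A,
    (∀ r ∈ rs, r ∈ IsLocalRing.maximalIdeal A) ∧
    RingTheory.Sequence.IsRegular A rs ∧
    (rs.length : WithBot ℕ∞) = ringKrullDim A ∧
    Module.finrank (A ⧸ IsLocalRing.maximalIdeal A) (socle A (A ⧸ Ideal.ofList rs)) = 1

/-- `x₁, …, x_d` is a system of parameters of the local ring `(A, 𝔪)`: `d = dim A` and the ideal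
`(x₁, …, x_d)` is `𝔪`-primary. -/
structure IsSystemOfParameters {A : Type*} [CommRing A] [IsLocalRing A] {d : ℕ}
    (x : Fin d → A) : Prop where
  dim_eq : ringKrullDim A = d
  radical_eq : (Ideal.span (Set.range x)).radical = IsLocalRing.maximalIdeal A

/-! ### The divided power module and the contraction action -/

/-- The `k`-vector space `Γ = k_DP[Z₁, …, Zₙ]` with basis the divided power monomials `Z^[L]`,
`L ∈ ℕⁿ`; an element is the finitely supported family of its coefficients. -/
def DividedPowers (n : ℕ) (k : Type*) [Field k] : Type _ := (Fin n →₀ ℕ) →₀ k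

namespace DividedPowers

variable {n : ℕ} {k : Type*} [Field k]

noncomputable instance : AddCommGroup (DividedPowers n k) :=
  inferInstanceAs (AddCommGroup ((Fin n →₀ ℕ) →₀ k))

/-- The element `b Z^[L]`. -/
noncomputable def monomial (L : Fin n →₀ ℕ) (b : k) : DividedPowers n k :=
  (Finsupp.single L b : (Fin n →₀ ℕ) →₀ k)

theorem monomial_zero (L : Fin n →₀ ℕ) : monomial L (0 : k) = 0 :=
  Finsupp.single_zero L

theorem monomial_add (L : Fin n →₀ ℕ) (a b : k) :
    monomial L (a + b) = monomial L a + monomial L b :=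
  Finsupp.single_add L a b

/-- The contraction `h ∘ (b Z^[L]) = ∑_{M ≤ L} a_M b Z^[L - M]` of a monomial by the power series
`h = ∑ a_M z^M`; the sum is over the pairs `p = (M, L - M)`. -/
noncomputable def contractMonomial (h : MvPowerSeries (Fin n) k) (L : Fin n →₀ ℕ) :
    k →+ DividedPowers n k where
  toFun b := ∑ p ∈ Finset.HasAntidiagonal.antidiagonal L, monomial p.2 (MvPowerSeries.coeff p.1 h * b)
  map_zero' := by simp [monomial_zero]
  map_add' a b := by simp [mul_add, monomial_add, Finset.sum_add_distrib]

/-- The contraction `h ∘ F = ∑_{M, L} a_M b_L Z^[L - M]` of `F = ∑ b_L Z^[L]` by the power series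
`h = ∑ a_M z^M`, where `Z^[L - M] = 0` unless `M ≤ L`. -/
noncomputable def contract (h : MvPowerSeries (Fin n) k) :
    DividedPowers n k →+ DividedPowers n k :=
  (Finsupp.liftAddHom (contractMonomial h) : ((Fin n →₀ ℕ) →₀ k) →+ DividedPowers n k)

theorem contract_monomial (h : MvPowerSeries (Fin n) k) (L : Fin n →₀ ℕ) (b : k) :
    contract h (monomial L b) =
      ∑ p ∈ Finset.HasAntidiagonal.antidiagonal L, monomial p.2 (MvPowerSeries.coeff p.1 h * b) :=
  Finsupp.liftAddHom_apply_single (contractMonomial h) L b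

theorem addHom_ext {f g : DividedPowers n k →+ DividedPowers n k}
    (h : ∀ L b, f (monomial L b) = g (monomial L b)) : f = g :=
  Finsupp.addHom_ext (f := (f : ((Fin n →₀ ℕ) →₀ k) →+ DividedPowers n k)) h

theorem contract_one : contract (1 : MvPowerSeries (Fin n) k) = AddMonoidHom.id _ := by
  classical
  refine addHom_ext fun L b => ?_
  rw [contract_monomial, Finset.sum_eq_single (0, L)]
  · simp
  · intro p hp hne
    have h0 : p.1 ≠ 0 := by
      rintro h0
      apply hne
      have := Finset.HasAntidiagonal.mem_antidiagonal.1 hp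
      rw [h0, zero_add] at this
      exact Prod.ext h0 this
    simp [MvPowerSeries.coeff_one, h0, monomial_zero]
  · intro h
    simp at h

theorem contract_add (g h : MvPowerSeries (Fin n) k) :
    contract (g + h) = contract g + contract h := by
  refine addHom_ext fun L b => ?_
  simp [contract_monomial, add_mul, monomial_add, Finset.sum_add_distrib]

theorem contract_mul (g h : MvPowerSeries (Fin n) k) :
    contract (g * h) = (contract g).comp (contract h) := by
  classical
  refine addHom_ext fun L b => ?_
  have hsum (s : Finset ((Fin n →₀ ℕ) × (Fin n →₀ ℕ))) (N : Fin n →₀ ℕ)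
      (f : (Fin n →₀ ℕ) × (Fin n →₀ ℕ) → k) :
      monomial N (∑ p ∈ s, f p) = ∑ p ∈ s, monomial N (f p) :=
    map_sum (AddMonoidHom.mk' (monomial N) (monomial_add N)) f s
  simp only [AddMonoidHom.comp_apply, contract_monomial, map_sum, MvPowerSeries.coeff_mul,
    Finset.sum_mul, hsum]
  rw [Finset.sum_sigma', Finset.sum_sigma']
  refine Finset.sum_bij'
    (fun x _ => ⟨(x.2.2, x.2.1 + x.1.2), (x.2.1, x.1.2)⟩)
    (fun x _ => ⟨(x.1.1 + x.2.1, x.2.2), (x.2.1, x.1.1)⟩) ?_ ?_ ?_ ?_ ?_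
  · rintro ⟨⟨a, c⟩, ⟨e, f⟩⟩ hx
    simp only [Finset.mem_sigma, Finset.HasAntidiagonal.mem_antidiagonal] at hx ⊢
    refine ⟨?_, trivial⟩
    rw [← hx.1, ← hx.2]; abel
  · rintro ⟨⟨a, c⟩, ⟨e, f⟩⟩ hx
    simp only [Finset.mem_sigma, Finset.HasAntidiagonal.mem_antidiagonal] at hx ⊢
    refine ⟨?_, add_comm _ _⟩
    rw [← hx.1, ← hx.2]; abel
  · rintro ⟨⟨a, c⟩, ⟨e, f⟩⟩ hx
    simp only [Finset.mem_sigma, Finset.HasAntidiagonal.mem_antidiagonal] at hx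
    obtain ⟨_, rfl⟩ := hx
    simp [add_comm]
  · rintro ⟨⟨a, c⟩, ⟨e, f⟩⟩ hx
    simp only [Finset.mem_sigma, Finset.HasAntidiagonal.mem_antidiagonal] at hx
    obtain ⟨_, rfl⟩ := hx
    simp
  · rintro ⟨⟨a, c⟩, ⟨e, f⟩⟩ hx
    simp [mul_assoc]

/-- `Γ` is a module over `R = k⟦z₁, …, zₙ⟧` by contraction. -/
noncomputable instance : Module (MvPowerSeries (Fin n) k) (DividedPowers n k) where
  smul h F := contract h F
  one_smul F := DFunLike.congr_fun contract_one F
  mul_smul g h F := DFunLike.congr_fun (contract_mul g h) F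
  smul_zero h := map_zero (contract h)
  smul_add h F G := map_add (contract h) F G
  add_smul g h F := DFunLike.congr_fun (contract_add g h) F
  zero_smul F := by
    have h0 : contract (0 : MvPowerSeries (Fin n) k) = 0 := by
      refine addHom_ext fun L b => ?_
      simp [contract_monomial, monomial_zero]
    exact DFunLike.congr_fun h0 F

theorem smul_def (h : MvPowerSeries (Fin n) k) (F : DividedPowers n k) :
    h • F = contract h F :=
  rfl

end DividedPowers

/-! ### Inverse systems and regular linear sequences -/

variable {n d : ℕ} {k : Type*} [Field k]

/-- Macaulay's inverse system `I^⊥ = {g ∈ Γ | f ∘ g = 0 for all f ∈ I}`. -/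
noncomputable def perp (I : Ideal (MvPowerSeries (Fin n) k)) :
    Submodule (MvPowerSeries (Fin n) k) (DividedPowers n k) :=
  Submodule.torsionBySet (MvPowerSeries (Fin n) k) (DividedPowers n k)
    (I : Set (MvPowerSeries (Fin n) k))

/-- `W_{z^L} = (I + (z₁^{l₁}, …, z_d^{l_d}))^⊥`. -/
noncomputable def W (I : Ideal (MvPowerSeries (Fin n) k)) (z : Fin d → MvPowerSeries (Fin n) k)
    (L : Fin d → ℕ) : Submodule (MvPowerSeries (Fin n) k) (DividedPowers n k) :=
  perp (I ⊔ Ideal.span (Set.range fun i => z i ^ L i))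

/-- `H` generates the cyclic `R`-submodule `N` of `Γ`. -/
def IsGenerator (H : DividedPowers n k)
    (N : Submodule (MvPowerSeries (Fin n) k) (DividedPowers n k)) : Prop :=
  Submodule.span (MvPowerSeries (Fin n) k) {H} = N

/-- `z₁, …, z_d ∈ R = k⟦x₁, …, xₙ⟧` is a regular linear sequence for `R ⧸ I`: it is the beginning of
a system `z₁, …, zₙ` of generators of the maximal ideal of `R` (such a system of `n = dim R`
generators is minimal, so that `z₁, …, z_d ∈ 𝔪 \ 𝔪²`), and the cosets of `z₁, …, z_d` form a system
of parameters of `R ⧸ I`. -/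
structure IsRegularLinearSequence (I : Ideal (MvPowerSeries (Fin n) k))
    [IsLocalRing (MvPowerSeries (Fin n) k ⧸ I)]
    (z : Fin d → MvPowerSeries (Fin n) k) : Prop where
  exists_minimal_generators : ∃ (hdn : d ≤ n) (w : Fin n → MvPowerSeries (Fin n) k),
    Ideal.span (Set.range w) = IsLocalRing.maximalIdeal (MvPowerSeries (Fin n) k) ∧
    ∀ i : Fin d, w (Fin.castLE hdn i) = z i
  isSystemOfParameters : IsSystemOfParameters fun i => Ideal.Quotient.mk I (z i)

end InverseSystem

/-! Contracting and then taking the constant coefficient pairs `R` with `Γ`. For an ideal `J`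
containing powers of all variables, the `k`-linear functionals on `R` that kill `J` are the elements
of `J^⊥` (`exists_pairing_eq`). So a lift `G` is a functional, and the conditions `z_i ∘ G = H_i`
prescribe it on multiples of the `z_i`: `∑ z_i f_i ↦ ∑ ⟨f_i, H_i⟩`, with `H_i = 0` when `l_i = 1`.
This is well defined modulo `I` because `z` is regular on `R ⧸ I`: its syzygies are Koszul, and
compatibility of the `H_i` makes the Koszul syzygies pair to zero
(`sum_smul_eq_zero_of_regularModulo`). Any linear extension to `R ⧸ I` kills the `z_i^{l_i}`, hence
gives `G ∈ W_L` (`exists_compatible_element`).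

`W_L` is cyclic because the quotient by `I + (z^L)` is Artinian with one-dimensional socle
(`exists_isGenerator`). If `G` were a nonunit multiple of a generator, a Nakayama argument would
force some `H_i = 0`, although `W_{L-γ_i} ≠ 0` (`exists_isGenerator_lift`). Part (2) is recursion on
`∑ l_i`.

The Gorenstein hypothesis provides just one good regular sequence. `CMTypeOne.of_systemOfParameters`
carries regularity and type one over to every system of parameters, in particular to all powers of
`z`. -/

namespace InverseSystem

open IsLocalRing

/-! ### Cohen-Macaulay rings of type one: independence of the system of parameters -/

section CohenMacaulay

variable {A : Type*} [CommRing A]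

/-- `x` is a nonzerodivisor on `A ⧸ J`. -/
def RegularModulo (J : Ideal A) (x : A) : Prop := ∀ a, x * a ∈ J → a ∈ J

theorem mem_sup_span_singleton {J : Ideal A} {x a : A} :
    a ∈ J ⊔ Ideal.span {x} ↔ ∃ c, a - x * c ∈ J := by
  rw [Submodule.mem_sup]
  constructor
  · rintro ⟨j, hj, y, hy, rfl⟩
    obtain ⟨c, rfl⟩ := Ideal.mem_span_singleton'.1 hy
    exact ⟨c, by convert hj using 1; ring⟩
  · rintro ⟨c, hc⟩
    exact ⟨_, hc, x * c, Ideal.mul_mem_right _ _ (Ideal.mem_span_singleton_self x), by ring⟩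

theorem mul_mem_sup_span_singleton (J : Ideal A) (x a : A) : x * a ∈ J ⊔ Ideal.span {x} :=
  mem_sup_span_singleton.2 ⟨a, by simp⟩

theorem RegularModulo.swap {J : Ideal A} {x y : A} (hx : RegularModulo J x)
    (hy : RegularModulo (J ⊔ Ideal.span {x}) y) : RegularModulo (J ⊔ Ideal.span {y}) x := by
  intro a ha
  obtain ⟨c, hc⟩ := mem_sup_span_singleton.1 ha
  have : c ∈ J ⊔ Ideal.span {x} := by
    refine hy _ (mem_sup_span_singleton.2 ⟨a, ?_⟩)
    convert J.neg_mem hc using 1; ring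
  obtain ⟨b, hb⟩ := mem_sup_span_singleton.1 this
  refine mem_sup_span_singleton.2 ⟨b, hx _ ?_⟩
  convert J.add_mem hc (J.mul_mem_left y hb) using 1; ring

/-- The relation `y s ≡ x s'` modulo `J` matches classes `s` modulo `J + (x)` with classes `s'`
modulo `J + (y)`; this is injectivity of the matching. If `s' ≡ y n`, cancel `y` in `y s ≡ x y n`.
-/
theorem mem_of_mem_exchange {J : Ideal A} {x y s s' : A} (hy : RegularModulo J y)
    (hs : y * s - x * s' ∈ J) (h : s' ∈ J ⊔ Ideal.span {y}) : s ∈ J ⊔ Ideal.span {x} := by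
  obtain ⟨n, hn⟩ := mem_sup_span_singleton.1 h
  refine mem_sup_span_singleton.2 ⟨n, hy _ ?_⟩
  convert J.add_mem hs (J.mul_mem_left x hn) using 1; ring

/-- The annihilator of a nonzero class in `A ⧸ J` lies in an associated prime, written here as a
colon `J : b`. -/
theorem exists_colon_prime [IsNoetherianRing A] {J : Ideal A} {a : A} (ha : a ∉ J) :
    ∃ (p : Ideal A) (b : A), p.IsPrime ∧ b ∉ J ∧ (∀ c, c ∈ p ↔ c * b ∈ J) ∧
      ∀ c, c * a ∈ J → c ∈ p := by
  obtain ⟨p, hp, hle⟩ := exists_le_isAssociatedPrime_of_isNoetherianRing A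
    (Ideal.Quotient.mk J a) (by rwa [ne_eq, Ideal.Quotient.eq_zero_iff_mem])
  rw [isAssociatedPrime_iff] at hp
  obtain ⟨hp, y, hy⟩ := hp
  obtain ⟨b, rfl⟩ := Ideal.Quotient.mk_surjective y
  have key (b c : A) : c ∈ (⊥ : Submodule A (A ⧸ J)).colon {Ideal.Quotient.mk J b} ↔ c * b ∈ J := by
    rw [Submodule.mem_colon_singleton, Submodule.mem_bot, ← Ideal.Quotient.eq_zero_iff_mem, map_mul]
    rfl
  have hmem : ∀ c, c ∈ p ↔ c * b ∈ J := fun c => by rw [hy, key]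
  refine ⟨p, b, hp, fun hb => hp.ne_top ?_, hmem, fun c hc => hle ((key a c).2 hc)⟩
  rw [Ideal.eq_top_iff_one, hmem, one_mul]
  exact hb

variable [IsLocalRing A]

/-- `a` represents an element of the socle of `A ⧸ J`. -/
def InSocle (J : Ideal A) (a : A) : Prop := ∀ y ∈ maximalIdeal A, y * a ∈ J

/-- The socle of `A ⧸ J` is one-dimensional. -/
def TypeOne (J : Ideal A) : Prop :=
  ∃ s, s ∉ J ∧ InSocle J s ∧ ∀ a, InSocle J a → ∃ c, a - c * s ∈ J

/-- `A ⧸ J` admits a regular sequence of length `d` in the maximal ideal such that the socle of the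
quotient by it is one-dimensional. -/
inductive CMTypeOne : ℕ → Ideal A → Prop
  | zero {J : Ideal A} : TypeOne J → CMTypeOne 0 J
  | succ {d : ℕ} {J : Ideal A} (r : A) : r ∈ maximalIdeal A → RegularModulo J r →
      CMTypeOne d (J ⊔ Ideal.span {r}) → CMTypeOne (d + 1) J

theorem InSocle.exchange {J : Ideal A} {x y s s' : A} (hx : RegularModulo J x)
    (h : InSocle (J ⊔ Ideal.span {x}) s) (hs : y * s - x * s' ∈ J) :
    InSocle (J ⊔ Ideal.span {y}) s' := by
  intro a ha
  obtain ⟨n, hn⟩ := mem_sup_span_singleton.1 (h a ha)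
  refine mem_sup_span_singleton.2 ⟨n, hx _ ?_⟩
  convert J.sub_mem (J.mul_mem_left y hn) (J.mul_mem_left a hs) using 1; ring

/-- Both socles are models of `Ext¹` of the residue field into `A ⧸ J`. Concretely, `y s ≡ x s'`
sends a socle generator `s` to `s'`, and the reversed relation for `t` yields the coefficient `c`.
-/
theorem TypeOne.exchange {J : Ideal A} {x y : A} (hxm : x ∈ maximalIdeal A)
    (hym : y ∈ maximalIdeal A) (hx : RegularModulo J x) (hy : RegularModulo J y)
    (h : TypeOne (J ⊔ Ideal.span {x})) : TypeOne (J ⊔ Ideal.span {y}) := by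
  obtain ⟨s, hs, hsoc, hgen⟩ := h
  obtain ⟨s', hs'⟩ := mem_sup_span_singleton.1 (hsoc y hym)
  refine ⟨s', fun h => hs (mem_of_mem_exchange hy hs' h), hsoc.exchange hx hs', fun t ht => ?_⟩
  obtain ⟨u, hu⟩ := mem_sup_span_singleton.1 (ht x hxm)
  obtain ⟨c, hc⟩ := hgen u (ht.exchange hy hu)
  obtain ⟨n, hn⟩ := mem_sup_span_singleton.1 hc
  refine ⟨c, mem_sup_span_singleton.2 ⟨n, hx _ ?_⟩⟩
  convert J.add_mem (J.add_mem hu (J.mul_mem_left y hn)) (J.mul_mem_left c hs') using 1; ring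

/-- The socle of `A ⧸ J` vanishes. -/
def SocleTrivial (J : Ideal A) : Prop := ∀ a, InSocle J a → a ∈ J

theorem SocleTrivial.of_regularModulo {J : Ideal A} {x : A} (hxm : x ∈ maximalIdeal A)
    (hx : RegularModulo J x) : SocleTrivial J :=
  fun a ha => hx a (ha x hxm)

theorem SocleTrivial.exchange {J : Ideal A} {x y : A} (hxm : x ∈ maximalIdeal A)
    (hx : RegularModulo J x) (hy : RegularModulo J y)
    (h : SocleTrivial (J ⊔ Ideal.span {x})) : SocleTrivial (J ⊔ Ideal.span {y}) := by
  intro a ha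
  obtain ⟨b, hb⟩ := mem_sup_span_singleton.1 (ha x hxm)
  exact mem_of_mem_exchange hx hb (h b (ha.exchange hy hb))

variable [IsNoetherianRing A]

/-- A trivial socle means that the maximal ideal is not an associated prime; prime avoidance applies
to the associated primes of both quotients together. -/
theorem exists_regularModulo {J K : Ideal A} (hJ : SocleTrivial J) (hK : SocleTrivial K) :
    ∃ w ∈ maximalIdeal A, RegularModulo J w ∧ RegularModulo K w := by
  classical
  have hfin (J : Ideal A) : (associatedPrimes A (A ⧸ J)).Finite := associatedPrimes.finite A _
  have hassoc (J : Ideal A) (hJ : SocleTrivial J) (p : Ideal A)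
      (hp : p ∈ associatedPrimes A (A ⧸ J)) : ¬ maximalIdeal A ≤ p := by
    intro hle
    obtain ⟨hp', y, hy⟩ := isAssociatedPrime_iff.1 hp
    obtain ⟨b, rfl⟩ := Ideal.Quotient.mk_surjective y
    have hmem (c : A) : c ∈ p ↔ c * b ∈ J := by
      rw [hy, Submodule.mem_colon_singleton, Submodule.mem_bot, ← Ideal.Quotient.eq_zero_iff_mem,
        map_mul]
      rfl
    have hb : b ∈ J := hJ b fun y hy => (hmem y).1 (hle hy)
    refine hp'.ne_top ((Ideal.eq_top_iff_one _).2 ?_)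
    rw [hmem, one_mul]; exact hb
  have hreg (J : Ideal A) (w : A) (hw : ∀ p ∈ associatedPrimes A (A ⧸ J), w ∉ p) :
      RegularModulo J w := by
    intro a ha
    by_contra haJ
    obtain ⟨p, hp, hle⟩ := exists_le_isAssociatedPrime_of_isNoetherianRing A
      (Ideal.Quotient.mk J a) (by rwa [ne_eq, Ideal.Quotient.eq_zero_iff_mem])
    refine hw p hp (hle ?_)
    rw [Submodule.mem_colon_singleton, Submodule.mem_bot]
    exact Ideal.Quotient.eq_zero_iff_mem.2 ha
  let S : Finset (Ideal A) := (hfin J).toFinset ∪ (hfin K).toFinset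
  have hS : ∀ p, p ∈ S ↔ p ∈ associatedPrimes A (A ⧸ J) ∨ p ∈ associatedPrimes A (A ⧸ K) := by
    simp [S]
  have hnot : ¬ ((maximalIdeal A : Set A) ⊆ ⋃ p ∈ (S : Set (Ideal A)), (p : Set A)) := by
    rw [Ideal.subset_union_prime (f := fun p : Ideal A => p) ⊥ ⊥]
    · rintro ⟨p, hp, hle⟩
      rcases (hS p).1 hp with h | h
      exacts [hassoc J hJ p h hle, hassoc K hK p h hle]
    · intro p hp _ _
      rcases (hS p).1 hp with h | h <;> exact h.isPrime
  obtain ⟨w, hw, hwS⟩ := Set.not_subset.1 hnot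
  simp only [Set.mem_iUnion, not_exists] at hwS
  exact ⟨w, hw, hreg J w fun p hp => hwS p ((hS p).2 (Or.inl hp)),
    hreg K w fun p hp => hwS p ((hS p).2 (Or.inr hp))⟩

/-- The given `r` and the desired `x` need not form a regular sequence together. They are linked by
a `w` regular modulo both `J + (r)` and `J + (x)`: induction applies to the pair `r, w` and then to
`w, x`, since regular pairs can be swapped. -/
theorem CMTypeOne.sup_span_singleton {d : ℕ} : ∀ {J : Ideal A} {x : A}, CMTypeOne (d + 1) J →
    x ∈ maximalIdeal A → RegularModulo J x → CMTypeOne d (J ⊔ Ideal.span {x}) := by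
  induction d with
  | zero =>
    intro J x h hxm hx
    obtain _ | ⟨r, hrm, hr, ⟨ht⟩⟩ := h
    exact .zero (ht.exchange hrm hxm hr hx)
  | succ d ih =>
    intro J x h hxm hx
    obtain _ | ⟨r, hrm, hr, h'⟩ := h
    have hsr : SocleTrivial (J ⊔ Ideal.span {r}) := by
      obtain _ | ⟨r', hrm', hr', _⟩ := h'
      exact .of_regularModulo hrm' hr'
    obtain ⟨w, hwm, hwr, hwx⟩ := exists_regularModulo hsr (hsr.exchange hrm hr hx)
    have hw : CMTypeOne (d + 1) (J ⊔ Ideal.span {w}) := by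
      refine .succ r hrm (hr.swap hwr) ?_
      rw [sup_right_comm]
      exact ih h' hwm hwr
    refine .succ w hwm hwx ?_
    rw [sup_right_comm]
    exact ih hw hxm (hx.swap hwx)

/-- Cutting by a regular `x` strictly enlarges associated primes: `x ∉ p`, while some class killed
by `p` survives modulo `J + (x)`, and an associated prime above its annihilator contains both `p`
and `x`. -/
theorem exists_colon_prime_gt {J p : Ideal A} [p.IsPrime] {a x : A} (hxm : x ∈ maximalIdeal A)
    (hx : RegularModulo J x) (ha : a ∉ J) (hp : ∀ c, c ∈ p ↔ c * a ∈ J) :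
    ∃ (q : Ideal A) (b : A), q.IsPrime ∧ p < q ∧ b ∉ J ⊔ Ideal.span {x} ∧
      ∀ c, c ∈ q ↔ c * b ∈ J ⊔ Ideal.span {x} := by
  have hxp : x ∉ p := fun h => ha (hx a ((hp x).1 h))
  let N : Ideal A :=
    { carrier := {b | ∀ c ∈ p, c * b ∈ J}
      zero_mem' := by simp
      add_mem' := fun hb hb' c hc => by rw [mul_add]; exact J.add_mem (hb c hc) (hb' c hc)
      smul_mem' := fun r b hb c hc => by
        rw [smul_eq_mul, mul_left_comm]; exact J.mul_mem_left r (hb c hc) }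
  have hN : ¬ N ≤ J ⊔ Ideal.span {x} := by
    intro hle
    have hNJ : N ≤ J := by
      -- Nakayama: if `b = x c` modulo `J`, regularity of `x` puts `c` in `N` too, so `N ≤ J + 𝔪 N`.
      refine Submodule.le_of_le_smul_of_le_jacobson_bot (I := maximalIdeal A)
        (IsNoetherian.noetherian N) (maximalIdeal_le_jacobson _) fun b hb => ?_
      obtain ⟨c, hc⟩ := mem_sup_span_singleton.1 (hle hb)
      have hcN : c ∈ N := by
        intro e he
        refine hx _ ?_
        convert J.sub_mem (hb e he) (J.mul_mem_left e hc) using 1; ring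
      rw [← sub_add_cancel b (x * c)]
      exact Submodule.add_mem_sup hc (Submodule.smul_mem_smul hxm hcN)
    exact ha (hNJ fun c hc => (hp c).1 hc)
  obtain ⟨b, hbN, hb⟩ := SetLike.not_le_iff_exists.1 hN
  obtain ⟨q, b', hq, hb', hmem, hle⟩ := exists_colon_prime hb
  refine ⟨q, b', hq, lt_of_le_of_ne (fun c hc => hle c (Ideal.mem_sup_left (hbN c hc))) ?_,
    hb', hmem⟩
  rintro rfl
  exact hxp (hle x (mul_mem_sup_span_singleton J x b))

/-- The coheight of `p` is `dim A ⧸ p`; each member of the regular sequence adds one strict step to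
a chain of primes above `p`. -/
theorem CMTypeOne.le_coheight {d : ℕ} {J : Ideal A} (h : CMTypeOne d J) :
    ∀ (p : PrimeSpectrum A) (a : A), a ∉ J → (∀ c, c ∈ p.asIdeal ↔ c * a ∈ J) →
      (d : ℕ∞) ≤ Order.coheight p := by
  induction h with
  | zero => simp
  | succ r hrm hr _ ih =>
    intro p a ha hp
    obtain ⟨q, b, hq, hlt, hb, hmem⟩ := exists_colon_prime_gt hrm hr ha hp
    push_cast
    exact (add_le_add_left (ih ⟨q, hq⟩ b hb hmem) 1).trans
      (Order.coheight_add_one_le (show p < ⟨q, hq⟩ from hlt))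

/-- Krull's height theorem in `A ⧸ p`, whose maximal ideal is minimal over the images of the `d`
elements. -/
theorem coheight_le_of_maximalIdeal_le_radical {d : ℕ} (p : PrimeSpectrum A) (z : Fin d → A)
    (hzm : ∀ i, z i ∈ maximalIdeal A)
    (h : maximalIdeal A ≤ (p.asIdeal ⊔ Ideal.span (Set.range z)).radical) :
    Order.coheight p ≤ d := by
  let f := Ideal.Quotient.mk p.asIdeal
  have hf : Function.Surjective f := Ideal.Quotient.mk_surjective
  have : IsLocalRing (A ⧸ p.asIdeal) := .of_surjective' f hf
  have : IsLocalHom f := IsLocalHom.of_surjective f hf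
  have hmap : ∀ a, f a ∈ maximalIdeal (A ⧸ p.asIdeal) ↔ a ∈ maximalIdeal A := fun a => by
    simp [mem_maximalIdeal, mem_nonunits_iff]
  have hdim : Order.coheight p = ringKrullDim (A ⧸ p.asIdeal) := by
    rw [Order.coheight_eq_krullDim_Ici, ringKrullDim_quotient]
    rfl
  rw [← maximalIdeal_height_eq_ringKrullDim] at hdim
  have hdim' : Order.coheight p = (maximalIdeal (A ⧸ p.asIdeal)).height := by exact_mod_cast hdim
  rw [hdim']
  have hmin : maximalIdeal (A ⧸ p.asIdeal) ∈
      (Ideal.span (Set.range fun i => f (z i))).minimalPrimes := by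
    refine ⟨⟨inferInstance, Ideal.span_le.2 ?_⟩, fun q hq _ => ?_⟩
    · rintro _ ⟨i, rfl⟩
      exact (hmap _).2 (hzm i)
    · intro x hx
      obtain ⟨a, rfl⟩ := hf x
      have hle : (p.asIdeal ⊔ Ideal.span (Set.range z)).radical ≤ q.comap f := by
        have := hq.1
        refine (Ideal.IsPrime.radical_le_iff inferInstance).2 (sup_le (fun c hc => ?_)
          (Ideal.span_le.2 ?_))
        · rw [Ideal.mem_comap, Ideal.Quotient.eq_zero_iff_mem.2 hc]
          exact q.zero_mem
        · rintro _ ⟨i, rfl⟩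
          exact hq.2 (Ideal.subset_span ⟨i, rfl⟩)
      exact hle (h ((hmap a).1 hx))
  refine (Ideal.height_le_card_of_mem_minimalPrimes_span (Set.finite_range _) hmin).trans ?_
  rw [← Set.image_univ]
  have := Set.ncard_image_le (f := fun i => f (z i)) (Set.finite_univ)
  rw [Set.ncard_univ, Nat.card_fin] at this
  exact_mod_cast this

/-- Otherwise `z 0` lies in an associated prime `p`. Then the other `d` elements already generate an
ideal primary to the maximal ideal modulo `p`, contradicting `dim A ⧸ p ≥ d + 1`. -/
theorem CMTypeOne.regularModulo {d : ℕ} {J : Ideal A} (h : CMTypeOne (d + 1) J)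
    (z : Fin (d + 1) → A) (hzm : ∀ i, z i ∈ maximalIdeal A)
    (hz : maximalIdeal A ≤ (J ⊔ Ideal.span (Set.range z)).radical) : RegularModulo J (z 0) := by
  intro a ha
  by_contra haJ
  obtain ⟨p, b, hp, hb, hmem, hle⟩ := exists_colon_prime haJ
  have h1 := h.le_coheight ⟨p, hp⟩ b hb hmem
  have h2 := coheight_le_of_maximalIdeal_le_radical ⟨p, hp⟩ (fun i => z (Fin.succ i)) (fun i => hzm _) <| by
    refine hz.trans (Ideal.radical_mono (sup_le ?_ (Ideal.span_le.2 ?_)))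
    · exact fun c hc => Ideal.mem_sup_left ((hmem c).2 (J.mul_mem_right _ hc))
    · rintro _ ⟨i, rfl⟩
      refine Fin.cases ?_ (fun i => ?_) i
      · exact Ideal.mem_sup_left (hle _ ha)
      · exact Ideal.mem_sup_right (Ideal.subset_span ⟨i, rfl⟩)
  have h3 := h1.trans h2
  norm_cast at h3
  omega

/-- In a Cohen-Macaulay ring of type one, a system of parameters is a regular sequence, and the
quotient by it has a one-dimensional socle. -/
theorem CMTypeOne.of_systemOfParameters {d : ℕ} : ∀ {J : Ideal A}, CMTypeOne d J →
    ∀ z : Fin d → A, (∀ i, z i ∈ maximalIdeal A) →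
      maximalIdeal A ≤ (J ⊔ Ideal.span (Set.range z)).radical →
      (∀ i, RegularModulo (J ⊔ Ideal.span (z '' {j | j < i})) (z i)) ∧
        TypeOne (J ⊔ Ideal.span (Set.range z)) := by
  induction d with
  | zero =>
    intro J h z _ _
    obtain ⟨h⟩ := h
    exact ⟨fun i => i.elim0, by simpa using h⟩
  | succ d ih =>
    intro J h z hzm hz
    have h0 := h.regularModulo z hzm hz
    have hrange : Set.range z = insert (z 0) (Set.range fun i => z (Fin.succ i)) := by
      rw [← Fin.cons_self_tail z, Fin.range_cons]; rfl
    have hsup : J ⊔ Ideal.span (Set.range z) =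
        J ⊔ Ideal.span {z 0} ⊔ Ideal.span (Set.range fun i => z (Fin.succ i)) := by
      rw [hrange, Ideal.span_insert, sup_assoc]
    rw [hsup] at hz ⊢
    obtain ⟨h1, h2⟩ := ih (h.sup_span_singleton (hzm 0) h0) _ (fun i => hzm _) hz
    refine ⟨fun i => ?_, h2⟩
    refine Fin.cases ?_ (fun i => ?_) i
    · simpa using h0
    · convert h1 i using 1
      rw [sup_assoc, ← Ideal.span_insert]
      congr 2
      ext a
      simp only [Set.mem_image, Set.mem_ofPred_eq, Set.mem_insert_iff]
      rw [Fin.exists_fin_succ]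
      simp [eq_comm]

end CohenMacaulay

/-! ### Syzygies of a regular sequence -/

/-- Compatible families `H` pair to zero with the syzygies of a regular sequence. -/
theorem sum_smul_eq_zero_of_regularModulo {R E : Type*} [CommRing R] [AddCommGroup E] [Module R E]
    {J : Ideal R} {d : ℕ} : ∀ (z : Fin d → R) (H : Fin d → E) (f : Fin d → R),
      (∀ i, RegularModulo (J ⊔ Ideal.span (z '' {j | j < i})) (z i)) →
      (∀ i, ∀ a ∈ J, a • H i = 0) → (∀ i j, z j • H i = z i • H j) →
      ∑ i, z i * f i ∈ J → ∑ i, f i • H i = 0 := by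
  induction d with
  | zero => simp
  | succ d ih =>
    intro z H f hreg hJ hcomp hf
    have himage : z '' {j | j < Fin.last d} = Set.range fun i : Fin d => z i.castSucc := by
      ext a
      simp only [Set.mem_image, Set.mem_ofPred_eq, Set.mem_range]
      rw [Fin.exists_fin_succ']
      simp [Fin.castSucc_lt_last]
    have hlast := hreg (Fin.last d)
    rw [himage] at hlast
    rw [Fin.sum_univ_castSucc] at hf
    have hmem : f (Fin.last d) ∈ J ⊔ Ideal.span (Set.range fun i : Fin d => z i.castSucc) := by
      refine hlast _ ?_
      rw [← add_sub_cancel_left (∑ i : Fin d, z i.castSucc * f i.castSucc)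
        (z (Fin.last d) * f (Fin.last d))]
      refine Ideal.sub_mem _ (Ideal.mem_sup_left hf) (Ideal.mem_sup_right ?_)
      exact Ideal.sum_mem _ fun i _ => Ideal.mul_mem_right _ _ (Ideal.subset_span ⟨i, rfl⟩)
    obtain ⟨a, ha, b, hb, hab⟩ := Submodule.mem_sup.1 hmem
    obtain ⟨c, rfl⟩ := Ideal.mem_span_range_iff_exists_fun.1 hb
    -- Modulo `J` the last coefficient is `∑ c_i z_i`. Subtracting the corresponding Koszul syzygies
    -- clears it and changes `f_i` to `f_i + c_i z_d`; by `hcomp` this does not alter `∑ f_i • H_i`.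
    have hinit := ih (fun i => z i.castSucc) (fun i => H i.castSucc)
      (fun i => f i.castSucc + c i * z (Fin.last d)) (fun i => ?_) (fun i => hJ _)
      (fun i j => hcomp _ _) ?_
    · rw [Fin.sum_univ_castSucc, ← hab, add_smul, hJ _ a ha, zero_add, Finset.sum_smul,
        ← Finset.sum_add_distrib, ← hinit]
      refine Finset.sum_congr rfl fun i _ => ?_
      rw [add_smul, mul_smul, mul_smul, hcomp]
    · convert hreg i.castSucc using 3
      ext a
      simp only [Set.mem_image, Set.mem_ofPred_eq]
      rw [Fin.exists_fin_succ' (P := fun x => x < i.castSucc ∧ z x = a)]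
      simp [not_lt.2 (Fin.le_last i.castSucc)]
    · convert J.sub_mem hf (J.mul_mem_left (z (Fin.last d)) ha) using 1
      rw [← hab, mul_add, Finset.mul_sum, add_sub_assoc, add_sub_cancel_left,
        ← Finset.sum_add_distrib]
      exact Finset.sum_congr rfl fun i _ => by ring

/-! ### Pulling back along a quotient map; essential socles -/

section Comap

variable {R A : Type*} [CommRing R] [CommRing A] {π : R →+* A}

theorem RegularModulo.comap {J : Ideal A} {x : R} (h : RegularModulo J (π x)) :
    RegularModulo (J.comap π) x := fun a ha => by
  rw [Ideal.mem_comap, map_mul] at ha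
  exact h _ ha

theorem TypeOne.comap [IsLocalRing R] [IsLocalRing A] (hπ : Function.Surjective π)
    {J : Ideal A} (h : TypeOne J) : TypeOne (J.comap π) := by
  have : IsLocalHom π := IsLocalHom.of_surjective π hπ
  have hmap : ∀ a, π a ∈ maximalIdeal A ↔ a ∈ maximalIdeal R := fun a => by
    simp [mem_maximalIdeal, mem_nonunits_iff]
  obtain ⟨s, hs, hsoc, hgen⟩ := h
  obtain ⟨s, rfl⟩ := hπ s
  refine ⟨s, hs, fun y hy => ?_, fun a ha => ?_⟩
  · rw [Ideal.mem_comap, map_mul]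
    exact hsoc _ ((hmap y).2 hy)
  · obtain ⟨c, hc⟩ := hgen (π a) fun y hy => by
      obtain ⟨y, rfl⟩ := hπ y
      rw [← map_mul]
      exact ha y ((hmap y).1 hy)
    obtain ⟨c, rfl⟩ := hπ c
    exact ⟨c, by rwa [Ideal.mem_comap, map_sub, map_mul]⟩

theorem comap_mk_span_range {ι : Type*} (I : Ideal R) (z : ι → R) :
    (Ideal.span (Set.range fun i => Ideal.Quotient.mk I (z i))).comap (Ideal.Quotient.mk I) =
      I ⊔ Ideal.span (Set.range z) := by
  rw [show (Set.range fun i => Ideal.Quotient.mk I (z i)) = Ideal.Quotient.mk I '' Set.range z from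
    Set.range_comp _ _, ← Ideal.map_span, Ideal.comap_map_of_surjective _
    Ideal.Quotient.mk_surjective, ← RingHom.ker_eq_comap_bot, Ideal.mk_ker, sup_comm]

theorem comap_mk_span_image {ι : Type*} (I : Ideal R) (z : ι → R) (s : Set ι) :
    (Ideal.span ((fun i => Ideal.Quotient.mk I (z i)) '' s)).comap (Ideal.Quotient.mk I) =
      I ⊔ Ideal.span (z '' s) := by
  rw [← Set.image_image (Ideal.Quotient.mk I), ← Ideal.map_span, Ideal.comap_map_of_surjective _
    Ideal.Quotient.mk_surjective, ← RingHom.ker_eq_comap_bot, Ideal.mk_ker, sup_comm]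

end Comap

/-- The socle of an Artinian quotient is essential: multiplying an element of `K` outside `J` as far
as possible without entering `J` gives a nonzero socle element, which is a unit multiple of `s`. -/
theorem TypeOne.mem_of_not_le {R : Type*} [CommRing R] [IsLocalRing R] {J K : Ideal R} {s : R}
    (hsoc : InSocle J s) (hgen : ∀ a, InSocle J a → ∃ c, a - c * s ∈ J)
    {N : ℕ} (hN : maximalIdeal R ^ N ≤ J) (hJK : J ≤ K) (hK : ¬ K ≤ J) : s ∈ K := by
  classical
  obtain ⟨a, haK, haJ⟩ := SetLike.not_le_iff_exists.1 hK
  have hex : ∃ m, ∀ b ∈ maximalIdeal R ^ m, b * a ∈ J :=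
    ⟨N, fun b hb => J.mul_mem_right _ (hN hb)⟩
  obtain ⟨m, hm⟩ : ∃ m, Nat.find hex = m + 1 := by
    refine Nat.exists_eq_succ_of_ne_zero fun h0 => haJ ?_
    have := Nat.find_spec hex 1
    rw [h0] at this
    simpa using this
  have hmin := Nat.find_min hex (m := m) (by omega)
  push Not at hmin
  obtain ⟨b, hb, hba⟩ := hmin
  have hsocle : InSocle J (b * a) := fun y hy => by
    rw [← mul_assoc]
    refine Nat.find_spec hex _ ?_
    rw [hm, pow_succ']
    exact Ideal.mul_mem_mul hy hb
  obtain ⟨c, hc⟩ := hgen _ hsocle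
  have hcu : IsUnit c := by
    by_contra hcu
    refine hba ?_
    rw [← sub_add_cancel (b * a) (c * s)]
    exact J.add_mem hc (hsoc c ((mem_maximalIdeal c).2 hcu))
  rw [← Ideal.unit_mul_mem_iff_mem K hcu, ← sub_sub_cancel (b * a) (c * s)]
  exact K.sub_mem (K.mul_mem_left _ haK) (hJK hc)

/-! ### Ideals containing powers of the variables are cofinite -/

section Box

variable {n : ℕ} {k : Type*} [Field k]

/-- The exponents all of whose entries are at most `N`. -/
noncomputable def box (n N : ℕ) : Finset (Fin n →₀ ℕ) :=
  Finset.Iic (Finsupp.equivFunOnFinite.symm fun _ => N)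

theorem exists_lt_of_notMem_box {N : ℕ} {M : Fin n →₀ ℕ} (h : M ∉ box n N) : ∃ i, N < M i := by
  by_contra! hc
  exact h (Finset.mem_Iic.2 fun i => by simpa using hc i)

theorem mem_of_coeff_box_eq_zero {J : Ideal (MvPowerSeries (Fin n) k)} {N : ℕ}
    (hJ : ∀ i, (MvPowerSeries.X i : MvPowerSeries (Fin n) k) ^ N ∈ J) (f : MvPowerSeries (Fin n) k)
    (hf : ∀ M ∈ box n N, MvPowerSeries.coeff M f = 0) : f ∈ J := by
  classical
  -- Each exponent outside the box is assigned to one variable whose power divides its monomial.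
  -- This splits the infinite series `f` into finitely many multiples of the `X_i^N`.
  let c : (Fin n →₀ ℕ) → Option (Fin n) := fun M =>
    if h : ∃ i, N < M i then some h.choose else none
  have hc {M : Fin n →₀ ℕ} {i : Fin n} (h : c M = some i) : N < M i := by
    by_cases hM : ∃ i, N < M i
    · simp only [c, dif_pos hM, Option.some.injEq] at h
      exact h ▸ hM.choose_spec
    · simp [c, hM] at h
  let g : Fin n → MvPowerSeries (Fin n) k := fun i M =>
    if c (M + Finsupp.single i N) = some i then
      MvPowerSeries.coeff (M + Finsupp.single i N) f else 0
  have hfg : f = ∑ i, MvPowerSeries.X i ^ N * g i := by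
    ext M
    have hterm (i : Fin n) : MvPowerSeries.coeff M (MvPowerSeries.X i ^ N * g i) =
        if c M = some i then MvPowerSeries.coeff M f else 0 := by
      rw [MvPowerSeries.X_pow_eq, MvPowerSeries.coeff_monomial_mul]
      by_cases hle : Finsupp.single i N ≤ M
      · rw [if_pos hle, one_mul]
        change (if c (M - Finsupp.single i N + Finsupp.single i N) = some i then _ else _) = _
        rw [tsub_add_cancel_of_le hle]
      · rw [if_neg hle, if_neg]
        intro h
        exact hle (Finsupp.single_le_iff.2 (hc h).le)
    rw [map_sum]
    simp only [hterm]
    rcases hcM : c M with _ | i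
    · have : M ∈ box n N := by
        by_contra hM
        simp [c, exists_lt_of_notMem_box hM] at hcM
      simp [hf M this]
    · simp
  rw [hfg]
  exact J.sum_mem fun i _ => J.mul_mem_right _ (hJ i)

theorem sub_sum_monomial_mem {J : Ideal (MvPowerSeries (Fin n) k)} {N : ℕ}
    (hJ : ∀ i, (MvPowerSeries.X i : MvPowerSeries (Fin n) k) ^ N ∈ J)
    (f : MvPowerSeries (Fin n) k) :
    f - ∑ M ∈ box n N, MvPowerSeries.coeff M f • MvPowerSeries.monomial M (1 : k) ∈ J := by
  classical
  refine mem_of_coeff_box_eq_zero hJ _ fun M hM => ?_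
  simp [MvPowerSeries.coeff_monomial, hM]

theorem finite_quotient {J : Ideal (MvPowerSeries (Fin n) k)} {N : ℕ}
    (hJ : ∀ i, (MvPowerSeries.X i : MvPowerSeries (Fin n) k) ^ N ∈ J) :
    Module.Finite k (MvPowerSeries (Fin n) k ⧸ J) := by
  classical
  refine ⟨(box n N).image
    fun M => Ideal.Quotient.mk J (MvPowerSeries.monomial M (1 : k)), ?_⟩
  rw [eq_top_iff]
  rintro x -
  obtain ⟨f, rfl⟩ := Ideal.Quotient.mk_surjective x
  rw [Ideal.Quotient.eq.2 (sub_sum_monomial_mem hJ f), map_sum]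
  refine Submodule.sum_mem _ fun M hM => ?_
  exact Submodule.smul_mem _ (MvPowerSeries.coeff M f)
    (Submodule.subset_span (Finset.mem_coe.2 (Finset.mem_image_of_mem _ hM)))

end Box

/-! ### Macaulay duality and cyclic inverse systems -/

section Pairing

variable {n : ℕ} {k : Type*} [Field k]

open InverseSystem.DividedPowers

/-- The coefficient of `1 = X^[0]`. -/
noncomputable def constCoeff : DividedPowers n k →+ k :=
  (Finsupp.applyAddHom 0 : ((Fin n →₀ ℕ) →₀ k) →+ k)

theorem constCoeff_monomial (L : Fin n →₀ ℕ) (b : k) :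
    constCoeff (monomial L b) = if L = 0 then b else 0 := by
  classical
  exact (Finsupp.single_apply ..)

theorem constCoeff_smul_monomial (f : MvPowerSeries (Fin n) k) (L : Fin n →₀ ℕ) (b : k) :
    constCoeff (f • monomial L b) = MvPowerSeries.coeff L f * b := by
  classical
  rw [smul_def, contract_monomial, map_sum, Finset.sum_eq_single (L, 0)]
  · simp [constCoeff_monomial]
  · intro p hp hne
    rw [constCoeff_monomial, if_neg]
    intro h0
    have := Finset.HasAntidiagonal.mem_antidiagonal.1 hp
    rw [h0, add_zero] at this
    exact hne (Prod.ext this h0)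
  · simp

/-- The functional `f ↦ ⟨f, g⟩` on power series, with `⟨f, g⟩` the constant coefficient of
`f ∘ g`. -/
noncomputable def pairing (g : DividedPowers n k) : MvPowerSeries (Fin n) k →ₗ[k] k where
  toFun f := constCoeff (f • g)
  map_add' f f' := by rw [add_smul, map_add]
  map_smul' c f := by
    have : (constCoeff.comp (contract (c • f)) : DividedPowers n k →+ k) =
        (AddMonoidHom.mulLeft c).comp (constCoeff.comp (contract f)) := by
      refine Finsupp.addHom_ext
        (f := (constCoeff.comp (contract (c • f)) : ((Fin n →₀ ℕ) →₀ k) →+ k)) fun L b => ?_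
      change constCoeff ((c • f) • monomial L b) = c * constCoeff (f • monomial L b)
      rw [constCoeff_smul_monomial, constCoeff_smul_monomial, map_smul, smul_eq_mul, mul_assoc]
    exact DFunLike.congr_fun this g

theorem pairing_monomial (f : MvPowerSeries (Fin n) k) (L : Fin n →₀ ℕ) (b : k) :
    pairing (monomial L b) f = MvPowerSeries.coeff L f * b :=
  constCoeff_smul_monomial f L b

theorem pairing_sum {ι : Type*} (s : Finset ι) (g : ι → DividedPowers n k)
    (f : MvPowerSeries (Fin n) k) : pairing (∑ i ∈ s, g i) f = ∑ i ∈ s, pairing (g i) f := by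
  change constCoeff (f • ∑ i ∈ s, g i) = _
  rw [Finset.smul_sum, map_sum]
  rfl

theorem pairing_zero (f : MvPowerSeries (Fin n) k) : pairing 0 f = 0 := by
  change constCoeff (f • (0 : DividedPowers n k)) = 0
  rw [smul_zero, map_zero]

theorem pairing_smul (a f : MvPowerSeries (Fin n) k) (g : DividedPowers n k) :
    pairing (a • g) f = pairing g (f * a) := by
  change constCoeff (f • a • g) = constCoeff ((f * a) • g)
  rw [mul_smul]

theorem pairing_monomial_one (g : DividedPowers n k) (L : Fin n →₀ ℕ) :
    pairing g (MvPowerSeries.monomial L 1) = DFunLike.coe (F := (Fin n →₀ ℕ) →₀ k) g L := by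
  classical
  have : (constCoeff.comp (contract (MvPowerSeries.monomial L 1)) : DividedPowers n k →+ k) =
      (Finsupp.applyAddHom L : ((Fin n →₀ ℕ) →₀ k) →+ k) := by
    refine Finsupp.addHom_ext (f := (constCoeff.comp (contract (MvPowerSeries.monomial L 1)) :
      ((Fin n →₀ ℕ) →₀ k) →+ k)) fun M b => ?_
    refine (constCoeff_smul_monomial _ M b).trans ?_
    rw [MvPowerSeries.coeff_monomial, Finsupp.applyAddHom_apply, Finsupp.single_apply]
    simp
  exact DFunLike.congr_fun this g

theorem eq_of_pairing_eq {g g' : DividedPowers n k} (h : ∀ f, pairing g f = pairing g' f) :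
    g = g' :=
  Finsupp.ext (f := (g : (Fin n →₀ ℕ) →₀ k)) fun L => by
    rw [← pairing_monomial_one, h, pairing_monomial_one]

theorem pairing_eq_zero_of_mem_perp {J : Ideal (MvPowerSeries (Fin n) k)} {g : DividedPowers n k}
    (hg : g ∈ perp J) {f : MvPowerSeries (Fin n) k} (hf : f ∈ J) : pairing g f = 0 := by
  have h : f • g = 0 := (Submodule.mem_torsionBySet_iff _ _).1 hg ⟨f, hf⟩
  change constCoeff (f • g) = 0
  rw [h, map_zero]

theorem mem_perp_of_pairing {J : Ideal (MvPowerSeries (Fin n) k)} {g : DividedPowers n k}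
    (hg : ∀ f ∈ J, pairing g f = 0) : g ∈ perp J := by
  refine (Submodule.mem_torsionBySet_iff _ _).2 fun ⟨a, ha⟩ => eq_of_pairing_eq fun f => ?_
  rw [pairing_smul, hg _ (J.mul_mem_left f ha), pairing_zero]

/-- Functionals vanishing on a cofinite ideal `J` are given by elements of `J^⊥`. -/
theorem exists_pairing_eq {J : Ideal (MvPowerSeries (Fin n) k)} {N : ℕ}
    (hJ : ∀ i, (MvPowerSeries.X i : MvPowerSeries (Fin n) k) ^ N ∈ J)
    (φ : MvPowerSeries (Fin n) k →ₗ[k] k) (hφ : ∀ f ∈ J, φ f = 0) :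
    ∃ g ∈ perp J, ∀ f, pairing g f = φ f := by
  -- The representing element is `∑ φ(x^M) X^[M]` over the box; beyond the box `f` contributes only
  -- elements of `J`, which `φ` kills.
  have key : ∀ f, pairing (∑ M ∈ box n N, monomial M (φ (MvPowerSeries.monomial M 1))) f = φ f := by
    intro f
    rw [pairing_sum, sub_eq_zero.1 ((map_sub φ _ _).symm.trans
      (hφ _ (sub_sum_monomial_mem hJ f))), map_sum]
    exact Finset.sum_congr rfl fun M _ => by rw [pairing_monomial, map_smul, smul_eq_mul]
  exact ⟨_, mem_perp_of_pairing fun f hf => by rw [key, hφ f hf], key⟩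

/-- A functional vanishing on `J`, viewed on the quotient by `J`. -/
noncomputable def quotientFunctional (J : Ideal (MvPowerSeries (Fin n) k))
    (φ : MvPowerSeries (Fin n) k →ₗ[k] k) (hφ : ∀ f ∈ J, φ f = 0) :
    (MvPowerSeries (Fin n) k ⧸ J) →ₗ[k] k :=
  ((J.restrictScalars k).liftQ φ fun f hf => hφ f hf) ∘ₗ
    (Submodule.Quotient.restrictScalarsEquiv k J).symm.toLinearMap

theorem quotientFunctional_mk (J : Ideal (MvPowerSeries (Fin n) k))
    (φ : MvPowerSeries (Fin n) k →ₗ[k] k) (hφ : ∀ f ∈ J, φ f = 0) (f : MvPowerSeries (Fin n) k) :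
    quotientFunctional J φ hφ (Ideal.Quotient.mk J f) = φ f :=
  rfl

/-- The inverse system of an Artinian ring with one-dimensional socle is cyclic. -/
theorem exists_isGenerator {J : Ideal (MvPowerSeries (Fin n) k)} {N : ℕ}
    (hN : maximalIdeal (MvPowerSeries (Fin n) k) ^ N ≤ J) (hJ : TypeOne J) :
    ∃ g, g ≠ 0 ∧ IsGenerator g (perp J) := by
  have hX : ∀ i, (MvPowerSeries.X i : MvPowerSeries (Fin n) k) ^ N ∈ J := fun i => by
    refine hN (Ideal.pow_mem_pow ?_ N)
    rw [mem_maximalIdeal, mem_nonunits_iff, MvPowerSeries.isUnit_iff_constantCoeff]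
    simp
  have := finite_quotient hX
  obtain ⟨s, hs, hsoc, hgen⟩ := hJ
  obtain ⟨ψ, hψ⟩ : ∃ ψ : Module.Dual k (MvPowerSeries (Fin n) k ⧸ J),
      ψ (Ideal.Quotient.mk J s) ≠ 0 := by
    by_contra! h
    exact hs (Ideal.Quotient.eq_zero_iff_mem.1 ((Module.forall_dual_apply_eq_zero_iff k _).1 h))
  obtain ⟨g, hg, hgφ⟩ := exists_pairing_eq hX
    (ψ ∘ₗ (Ideal.Quotient.mkₐ k J).toLinearMap) fun f hf => by
      simp [Ideal.Quotient.eq_zero_iff_mem.2 hf]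
  have hgs : pairing g s ≠ 0 := by rw [hgφ]; exact hψ
  -- The annihilator of `g` contains `J`; were it larger, it would contain `s`, on which `g` is
  -- nonzero.
  have hann (a : MvPowerSeries (Fin n) k) (ha : a • g = 0) : a ∈ J := by
    let K : Ideal (MvPowerSeries (Fin n) k) := (⊥ : Submodule _ _).colon {g}
    have hK (a : MvPowerSeries (Fin n) k) : a ∈ K ↔ a • g = 0 := by
      rw [Submodule.mem_colon_singleton, Submodule.mem_bot]
    have hJK : J ≤ K := fun a ha =>
      (hK a).2 ((Submodule.mem_torsionBySet_iff _ _).1 hg ⟨a, ha⟩)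
    by_contra haJ
    have := TypeOne.mem_of_not_le hsoc hgen hN hJK fun hle => haJ (hle ((hK a).2 ha))
    apply hgs
    change constCoeff (s • g) = 0
    rw [(hK s).1 this, map_zero]
  refine ⟨g, ?_, le_antisymm ((Submodule.span_singleton_le_iff_mem _ _).2 hg) fun h hh => ?_⟩
  · rintro rfl
    exact hgs (pairing_zero s)
  · let φ := quotientFunctional J (pairing g) fun f hf => pairing_eq_zero_of_mem_perp hg hf
    -- `T` sends `a` to the functional of `a ∘ g`. It is injective by `hann`, hence onto the dual by
    -- equality of dimensions, so every `h` in `J^⊥` is a multiple of `g`.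
    let T : (MvPowerSeries (Fin n) k ⧸ J) →ₗ[k] Module.Dual k (MvPowerSeries (Fin n) k ⧸ J) :=
      (LinearMap.mul k _).compr₂ φ
    have hT (a b : MvPowerSeries (Fin n) k) :
        T (Ideal.Quotient.mk J a) (Ideal.Quotient.mk J b) = pairing (a • g) b := by
      rw [pairing_smul, mul_comm]
      rfl
    have hinj : Function.Injective T := by
      rw [injective_iff_map_eq_zero]
      intro x hx
      obtain ⟨a, rfl⟩ := Ideal.Quotient.mk_surjective x
      refine Ideal.Quotient.eq_zero_iff_mem.2 (hann a (eq_of_pairing_eq fun b => ?_))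
      rw [← hT, hx, pairing_zero, LinearMap.zero_apply]
    have hsurj : Function.Surjective T :=
      (LinearMap.injective_iff_surjective_of_finrank_eq_finrank
        Subspace.dual_finrank_eq.symm).1 hinj
    obtain ⟨x, hx⟩ := hsurj
      (quotientFunctional J (pairing h) fun f hf => pairing_eq_zero_of_mem_perp hh hf)
    obtain ⟨a, rfl⟩ := Ideal.Quotient.mk_surjective x
    refine Submodule.mem_span_singleton.2 ⟨a, eq_of_pairing_eq fun b => ?_⟩
    rw [← hT, hx, quotientFunctional_mk]

end Pairing

theorem IsGorensteinLocalRing.cmTypeOne {A : Type*} [CommRing A] [IsLocalRing A]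
    (hA : IsGorensteinLocalRing A) {d : ℕ} (hd : ringKrullDim A = d) :
    CMTypeOne d (⊥ : Ideal A) := by
  obtain ⟨rs, hmem, hreg, hlen, hsoc⟩ := hA.exists_regular
  rw [hd] at hlen
  have hlen' : rs.length = d := by exact_mod_cast hlen
  -- Here `m` counts the members of `rs` still to be cut by, after the first `i`; the socle
  -- hypothesis is the case `m = 0`.
  have key : ∀ m i, i + m = rs.length → CMTypeOne m (Ideal.ofList (rs.take i)) := by
    intro m
    induction m with
    | zero =>
      intro i hi
      rw [List.take_of_length_le (by omega)]
      have : Module.Free (A ⧸ maximalIdeal A) (socle A (A ⧸ Ideal.ofList rs)) :=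
        letI := Ideal.Quotient.field (maximalIdeal A)
        Module.Free.of_divisionRing _ _
      obtain ⟨v, hv0, hv⟩ := finrank_eq_one_iff'.1 hsoc
      obtain ⟨⟨v, hvs⟩, rfl⟩ : ∃ w, w = v := ⟨v, rfl⟩
      obtain ⟨s, rfl⟩ := Ideal.Quotient.mk_surjective v
      have hmk (a : A) : (Ideal.Quotient.mk (Ideal.ofList rs) a ∈
          socle A (A ⧸ Ideal.ofList rs)) ↔ InSocle (Ideal.ofList rs) a := by
        rw [Submodule.mem_torsionBySet_iff]
        refine ⟨fun h y hy => Ideal.Quotient.eq_zero_iff_mem.1 (h ⟨y, hy⟩),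
          fun h y => Ideal.Quotient.eq_zero_iff_mem.2 (h y y.2)⟩
      refine .zero ⟨s, fun hs => hv0 ?_, (hmk s).1 hvs, fun a ha => ?_⟩
      · exact Subtype.ext (Ideal.Quotient.eq_zero_iff_mem.2 hs)
      · obtain ⟨c, hc⟩ := hv ⟨_, (hmk a).2 ha⟩
        obtain ⟨c, rfl⟩ := Ideal.Quotient.mk_surjective c
        refine ⟨c, Ideal.Quotient.eq.1 ?_⟩
        exact (congrArg Subtype.val hc).symm
    | succ m ih =>
      intro i hi
      have hlt : i < rs.length := by omega
      refine .succ rs[i] (hmem _ (List.getElem_mem hlt)) ?_ ?_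
      · intro a ha
        have h := hreg.regular_mod_prev i hlt
        rw [smul_eq_mul, Ideal.mul_top] at h
        have h0 : rs[i] • (Ideal.Quotient.mk (Ideal.ofList (rs.take i)) a) =
            rs[i] • (0 : A ⧸ Ideal.ofList (rs.take i)) := by
          rw [smul_zero]
          exact Ideal.Quotient.eq_zero_iff_mem.2 ha
        exact Ideal.Quotient.eq_zero_iff_mem.1 (h h0)
      · have := ih (i + 1) (by omega)
        rwa [← List.take_concat_get' rs i hlt, Ideal.ofList_append, Ideal.ofList_singleton] at this
  have := key d 0 (by omega)
  rwa [List.take_zero, Ideal.ofList_nil] at this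

/-! ### Lifting generators from level to level -/

section Levels

variable {k : Type*} [Field k] {n d : ℕ} {I : Ideal (MvPowerSeries (Fin n) k)}
  {z : Fin d → MvPowerSeries (Fin n) k}

theorem smul_eq_zero_of_mem_perp {J : Ideal (MvPowerSeries (Fin n) k)} {g : DividedPowers n k}
    (hg : g ∈ perp J) {f : MvPowerSeries (Fin n) k} (hf : f ∈ J) : f • g = 0 :=
  (Submodule.mem_torsionBySet_iff _ _).1 hg ⟨f, hf⟩

/-- Positive powers of a system of parameters again form one, so the Cohen-Macaulay theorem applies
in `R ⧸ I` and pulls back to `R`. -/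
theorem IsRegularLinearSequence.regularModulo_and_typeOne
    [IsLocalRing (MvPowerSeries (Fin n) k ⧸ I)]
    (hI : IsGorensteinLocalRing (MvPowerSeries (Fin n) k ⧸ I))
    (hz : IsRegularLinearSequence I z) {L : Fin d → ℕ} (hL : ∀ i, 1 ≤ L i) :
    (∀ i, RegularModulo (I ⊔ Ideal.span ((fun i => z i ^ L i) '' {j | j < i})) (z i ^ L i)) ∧
      TypeOne (I ⊔ Ideal.span (Set.range fun i => z i ^ L i)) ∧
      ∃ N, maximalIdeal (MvPowerSeries (Fin n) k) ^ N ≤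
        I ⊔ Ideal.span (Set.range fun i => z i ^ L i) := by
  have := hI.noetherian
  let π := Ideal.Quotient.mk I
  have hπ : Function.Surjective π := Ideal.Quotient.mk_surjective
  have hloc : IsLocalHom π := IsLocalHom.of_surjective π hπ
  have hmap : ∀ a, π a ∈ maximalIdeal (MvPowerSeries (Fin n) k ⧸ I) ↔ a ∈ maximalIdeal _ :=
    fun a => by simp [mem_maximalIdeal, mem_nonunits_iff]
  obtain ⟨hdim, hrad⟩ := hz.isSystemOfParameters
  have hzm (i : Fin d) : π (z i) ∈ maximalIdeal (MvPowerSeries (Fin n) k ⧸ I) := by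
    rw [← hrad]
    exact Ideal.le_radical (Ideal.subset_span ⟨i, rfl⟩)
  have hradL : maximalIdeal (MvPowerSeries (Fin n) k ⧸ I) ≤
      (Ideal.span (Set.range fun i => π (z i ^ L i))).radical := by
    rw [← hrad, Ideal.radical_le_radical_iff, Ideal.span_le]
    rintro _ ⟨i, rfl⟩
    exact ⟨L i, Ideal.subset_span ⟨i, map_pow π _ _⟩⟩
  obtain ⟨hreg, htype⟩ := (hI.cmTypeOne hdim).of_systemOfParameters (fun i => π (z i ^ L i))
    (fun i => by
      rw [map_pow]
      exact Ideal.pow_mem_of_mem _ (hzm i) _ (hL i)) (by rwa [bot_sup_eq])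
  rw [bot_sup_eq] at htype
  refine ⟨fun i => ?_, ?_, ?_⟩
  · rw [← comap_mk_span_image]
    have := hreg i
    rw [bot_sup_eq] at this
    exact this.comap
  · rw [← comap_mk_span_range]
    exact htype.comap hπ
  · obtain ⟨_, w, hw, _⟩ := hz.exists_minimal_generators
    refine Ideal.exists_pow_le_of_le_radical_of_fg (fun a ha => ?_) ?_
    · obtain ⟨m, hm⟩ := hradL ((hmap a).2 ha)
      refine ⟨m, ?_⟩
      rw [← comap_mk_span_range, Ideal.mem_comap, map_pow]
      exact hm
    · rw [← hw]
      exact Submodule.fg_span (Set.finite_range w)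

theorem exists_compatible_element {N : ℕ}
    (hreg : ∀ i, RegularModulo (I ⊔ Ideal.span (z '' {j | j < i})) (z i))
    {L : Fin d → ℕ} (hL : ∀ i, 1 ≤ L i)
    (hN : ∀ i, (MvPowerSeries.X i : MvPowerSeries (Fin n) k) ^ N ∈
      I ⊔ Ideal.span (Set.range fun i => z i ^ L i))
    (H : Fin d → DividedPowers n k) (hIH : ∀ i, ∀ a ∈ I, a • H i = 0)
    (hcomp : ∀ i j, z j • H i = z i • H j) (hpow : ∀ i, z i ^ (L i - 1) • H i = 0) :
    ∃ G ∈ W I z L, ∀ i, z i • G = H i := by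
  classical
  let Φ : (Fin d → MvPowerSeries (Fin n) k) →ₗ[k] MvPowerSeries (Fin n) k ⧸ I :=
    (Ideal.Quotient.mkₐ k I).toLinearMap ∘ₗ
      ∑ i, LinearMap.mulLeft k (z i) ∘ₗ LinearMap.proj i
  let Ψ : (Fin d → MvPowerSeries (Fin n) k) →ₗ[k] k := ∑ i, pairing (H i) ∘ₗ LinearMap.proj i
  have hΦ (f) : Φ f = Ideal.Quotient.mk I (∑ i, z i * f i) := by
    simp [Φ]
  have hΨ (f) : Ψ f = ∑ i, pairing (H i) (f i) := by
    simp [Ψ]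
  have hker : Ψ ∈ (LinearMap.ker Φ).dualAnnihilator := by
    rw [Submodule.mem_dualAnnihilator]
    intro f hf
    rw [LinearMap.mem_ker, hΦ, Ideal.Quotient.eq_zero_iff_mem] at hf
    have := sum_smul_eq_zero_of_regularModulo z H f hreg hIH hcomp hf
    calc Ψ f = ∑ i, pairing (f i • H i) 1 := by
          rw [hΨ]
          exact Finset.sum_congr rfl fun i _ => by rw [pairing_smul, one_mul]
      _ = 0 := by rw [← pairing_sum, this, pairing_zero]
  -- Over a field, a functional vanishing on `ker Φ` factors through `Φ`: this descends to the image
  -- of `(z)` and extends to all of `R ⧸ I` at once.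
  rw [← LinearMap.range_dualMap_eq_dualAnnihilator_ker] at hker
  obtain ⟨φ, hφ⟩ := hker
  have hφΨ (f : Fin d → MvPowerSeries (Fin n) k) : φ (Ideal.Quotient.mk I (∑ i, z i * f i)) = ∑ i, pairing (H i) (f i) := by
    rw [← hΦ, ← hΨ, ← hφ]
    rfl
  obtain ⟨G, hG, hGφ⟩ := exists_pairing_eq hN (φ ∘ₗ (Ideal.Quotient.mkₐ k I).toLinearMap) <| by
    intro f hf
    obtain ⟨a, ha, b, hb, rfl⟩ := Submodule.mem_sup.1 hf
    obtain ⟨c, rfl⟩ := Ideal.mem_span_range_iff_exists_fun.1 hb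
    have hsum : ∑ i, c i * z i ^ L i = ∑ i, z i * (c i * z i ^ (L i - 1)) :=
      Finset.sum_congr rfl fun i _ => by
        rw [mul_left_comm, ← pow_succ', Nat.sub_add_cancel (hL i)]
    change φ (Ideal.Quotient.mk I _) = 0
    rw [map_add, Ideal.Quotient.eq_zero_iff_mem.2 ha, zero_add, hsum, hφΨ]
    refine Finset.sum_eq_zero fun i _ => ?_
    rw [← pairing_smul, hpow, pairing_zero]
  refine ⟨G, hG, fun i => eq_of_pairing_eq fun f => ?_⟩
  have hsingle := hφΨ (Pi.single i f)
  rw [Finset.sum_eq_single i (fun j _ hj => by simp [Pi.single_eq_of_ne hj]) (by simp),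
    Finset.sum_eq_single i (fun j _ hj => by simp [Pi.single_eq_of_ne hj]) (by simp),
    Pi.single_eq_same] at hsingle
  rw [pairing_smul, hGφ, mul_comm]
  exact hsingle

theorem exists_isGenerator_lift [IsLocalRing (MvPowerSeries (Fin n) k ⧸ I)]
    (hI : IsGorensteinLocalRing (MvPowerSeries (Fin n) k ⧸ I))
    (hz : IsRegularLinearSequence I z) {L : Fin d → ℕ} (hL : ∀ i, 1 ≤ L i)
    (H : Fin d → DividedPowers n k)
    (hH : ∀ i, 2 ≤ L i → IsGenerator (H i) (W I z (L - Pi.single i 1)))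
    (hcomp : ∀ i j, 2 ≤ L i → 2 ≤ L j → z j • H i = z i • H j) :
    ∃ G, IsGenerator G (W I z L) ∧ ∀ i, 2 ≤ L i → z i • G = H i := by
  classical
  have hcyc {L : Fin d → ℕ} (hL : ∀ i, 1 ≤ L i) : ∃ g, g ≠ 0 ∧ IsGenerator g (W I z L) := by
    obtain ⟨_, htype, N, hN⟩ := hz.regularModulo_and_typeOne hI hL
    exact exists_isGenerator hN htype
  obtain ⟨g, -, hg⟩ := hcyc hL
  by_cases hex : ∃ i, 2 ≤ L i
  swap
  · exact ⟨g, hg, fun i hi => absurd ⟨i, hi⟩ hex⟩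
  obtain ⟨i₀, hi₀⟩ := hex
  -- The level `L = 1` gives regularity of `z` itself.
  have hreg : ∀ i, RegularModulo (I ⊔ Ideal.span (z '' {j | j < i})) (z i) := by
    simpa using (hz.regularModulo_and_typeOne hI (L := 1) fun _ => le_rfl).1
  obtain ⟨_, _, N, hN⟩ := hz.regularModulo_and_typeOne hI hL
  have hHW (i : Fin d) (hi : 2 ≤ L i) : H i ∈ W I z (L - Pi.single i 1) :=
    hH i hi ▸ Submodule.mem_span_singleton_self _
  have hkill (i j : Fin d) (hi : 2 ≤ L i) : z j ^ (L - Pi.single i 1 : Fin d → ℕ) j • H i = 0 :=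
    smul_eq_zero_of_mem_perp (hHW i hi) (Ideal.mem_sup_right (Ideal.subset_span ⟨j, rfl⟩))
  have hkill_of_one (i j : Fin d) (hi : 2 ≤ L i) (hj : ¬ 2 ≤ L j) : z j • H i = 0 := by
    have hne : j ≠ i := by rintro rfl; exact hj hi
    have hj1 : L j = 1 := le_antisymm (by omega) (hL j)
    simpa [hne, hj1] using hkill i j hi
  obtain ⟨G, hG, hGH⟩ := exists_compatible_element hreg hL (N := N)
    (fun i => hN (Ideal.pow_mem_pow (by
      rw [mem_maximalIdeal, mem_nonunits_iff, MvPowerSeries.isUnit_iff_constantCoeff]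
      simp) N))
    -- Zero is the right filler when `l_i = 1`: `z_i` then kills `W_L` and every `H_j`, so
    -- compatibility persists.
    (fun i => if 2 ≤ L i then H i else 0)
    (fun i a ha => by
      split_ifs with hi
      · exact smul_eq_zero_of_mem_perp (hHW i hi) (Ideal.mem_sup_left ha)
      · exact smul_zero a)
    (fun i j => by
      split_ifs with hi hj hj
      · exact hcomp i j hi hj
      · rw [hkill_of_one i j hi hj, smul_zero]
      · rw [hkill_of_one j i hj hi, smul_zero]
      · rw [smul_zero, smul_zero])
    (fun i => by
      split_ifs with hi
      · simpa using hkill i i hi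
      · exact smul_zero _)
  replace hGH (i : Fin d) (hi : 2 ≤ L i) : z i • G = H i := by rw [hGH, if_pos hi]
  refine ⟨G, ?_, hGH⟩
  obtain ⟨u, rfl⟩ := Submodule.mem_span_singleton.1 (hg.symm ▸ hG)
  suffices hu : IsUnit u by
    rw [IsGenerator, Submodule.span_singleton_smul_eq hu, hg]
  -- With `u` a nonunit, `z_{i₀} ∘ g = v ∘ H_{i₀}` gives `H_{i₀} = uv ∘ H_{i₀}`, hence `H_{i₀} = 0`,
  -- whereas it generates a nonzero module.
  by_contra hu
  have hL' : ∀ i, 1 ≤ (L - Pi.single i₀ 1 : Fin d → ℕ) i := fun i => by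
    by_cases h : i = i₀
    · subst h; simp; omega
    · simpa [h] using hL i
  have hzg : z i₀ • g ∈ W I z (L - Pi.single i₀ 1) := by
    have hgW : g ∈ W I z L := hg ▸ Submodule.mem_span_singleton_self _
    refine (Submodule.mem_torsionBySet_iff _ _).2 fun ⟨a, ha⟩ => ?_
    change a • z i₀ • g = 0
    rw [← mul_smul]
    refine smul_eq_zero_of_mem_perp hgW ?_
    obtain ⟨b, hb, c, hc, rfl⟩ := Submodule.mem_sup.1 ha
    rw [add_mul]
    refine Ideal.add_mem _ (Ideal.mem_sup_left (I.mul_mem_right _ hb)) (Ideal.mem_sup_right ?_)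
    obtain ⟨e, rfl⟩ := Ideal.mem_span_range_iff_exists_fun.1 hc
    rw [Finset.sum_mul]
    refine Ideal.sum_mem _ fun i _ => ?_
    rw [mul_assoc]
    refine Ideal.mul_mem_left _ _ ?_
    by_cases h : i = i₀
    · subst h
      have : (L - Pi.single i 1 : Fin d → ℕ) i + 1 = L i := by simp; omega
      rw [← pow_succ, this]
      exact Ideal.subset_span ⟨i, rfl⟩
    · have : (L - Pi.single i₀ 1 : Fin d → ℕ) i = L i := by simp [h]
      rw [this]
      exact Ideal.mul_mem_right _ _ (Ideal.subset_span ⟨i, rfl⟩)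
  obtain ⟨v, hv⟩ := Submodule.mem_span_singleton.1 ((hH i₀ hi₀).symm ▸ hzg)
  have hunit : IsUnit (1 - u * v) := by
    by_contra h
    refine one_notMem_nonunits (α := MvPowerSeries (Fin n) k) ?_
    rw [← sub_add_cancel 1 (u * v)]
    exact nonunits_add h (mul_mem_nonunits_left hu)
  have hH0 : H i₀ = 0 := by
    refine hunit.smul_left_cancel.1 ?_
    rw [smul_zero, sub_smul, one_smul, mul_smul, hv, ← mul_smul, mul_comm, mul_smul,
      hGH i₀ hi₀, sub_self]
  obtain ⟨g', hg'0, hg'⟩ := hcyc hL'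
  have : g' ∈ W I z (L - Pi.single i₀ 1) := hg' ▸ Submodule.mem_span_singleton_self _
  rw [← hH i₀ hi₀, hH0, Submodule.mem_span_singleton] at this
  obtain ⟨c, hc⟩ := this
  exact hg'0 (by rw [← hc, smul_zero])

theorem sum_sub_single_lt {L : Fin d → ℕ} {i : Fin d} (hi : 2 ≤ L i) :
    ∑ j, (L - Pi.single i 1 : Fin d → ℕ) j < ∑ j, L j := by
  refine Finset.sum_lt_sum (fun j _ => Nat.sub_le _ _) ⟨i, Finset.mem_univ i, ?_⟩
  simp
  omega

/-- A recursively defined family on `ℕ^d`: the value at `L` is a solution of `P L`, relative to the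
values at the lower neighbours of `L`, if there is one. -/
theorem exists_family_of_lift {E : Type*} [Inhabited E]
    (P : (L : Fin d → ℕ) → ((i : Fin d) → 2 ≤ L i → E) → E → Prop) :
    ∃ F : (Fin d → ℕ) → E, ∀ L, (∃ x, P L (fun i _ => F (L - Pi.single i 1)) x) →
      P L (fun i _ => F (L - Pi.single i 1)) (F L) := by
  classical
  let wf : WellFounded fun L L' : Fin d → ℕ => ∑ j, L j < ∑ j, L' j :=
    (measure fun L : Fin d → ℕ => ∑ j, L j).wf
  -- Choosing a default value when no solution exists separates the recursion from the proof of
  -- solvability, which is needed only at positive levels.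
  let step (L : Fin d → ℕ) (rec : ∀ L' : Fin d → ℕ, ∑ j, L' j < ∑ j, L j → E) : E :=
    if h : ∃ x, P L (fun i hi => rec (L - Pi.single i 1) (sum_sub_single_lt hi)) x then h.choose
    else default
  refine ⟨wf.fix step, fun L hL => ?_⟩
  rw [wf.fix_eq step L]
  change P L _ (dite _ _ _)
  rw [dif_pos hL]
  exact hL.choose_spec

theorem exists_compatible_family [IsLocalRing (MvPowerSeries (Fin n) k ⧸ I)]
    (hI : IsGorensteinLocalRing (MvPowerSeries (Fin n) k ⧸ I))
    (hz : IsRegularLinearSequence I z) {H₁ : DividedPowers n k}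
    (hH₁ : IsGenerator H₁ (W I z 1)) :
    ∃ H : (Fin d → ℕ) → DividedPowers n k, H 1 = H₁ ∧
      ∀ L : Fin d → ℕ, (∀ i, 1 ≤ L i) →
        IsGenerator (H L) (W I z L) ∧ ∀ i, 2 ≤ L i → z i • H L = H (L - Pi.single i 1) := by
  have : Inhabited (DividedPowers n k) := ⟨0⟩
  obtain ⟨F, hF⟩ := exists_family_of_lift (d := d) (E := DividedPowers n k)
    -- The first clause anchors the recursion at the prescribed generator.
    fun L below x => (L = 1 → x = H₁) ∧ IsGenerator x (W I z L) ∧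
      ∀ i (hi : 2 ≤ L i), z i • x = below i hi
  have hF1 := hF 1 ⟨H₁, fun _ => rfl, hH₁, fun i hi => by simp at hi⟩
  have key : ∀ m, ∀ L : Fin d → ℕ, ∑ j, L j = m → (∀ i, 1 ≤ L i) →
      IsGenerator (F L) (W I z L) ∧ ∀ i, 2 ≤ L i → z i • F L = F (L - Pi.single i 1) := by
    intro m
    induction m using Nat.strong_induction_on with
    | _ m ih =>
      rintro L rfl hL
      by_cases hL1 : L = 1
      · subst hL1
        exact hF1.2
      have hpred {i : Fin d} (hi : 2 ≤ L i) : ∀ j, 1 ≤ (L - Pi.single i 1 : Fin d → ℕ) j := fun j => by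
        by_cases h : j = i
        · subst h; simp; omega
        · simpa [h] using hL j
      have ih' {i : Fin d} (hi : 2 ≤ L i) := ih _ (sum_sub_single_lt hi) _ rfl (hpred hi)
      obtain ⟨G, hG, hGF⟩ := exists_isGenerator_lift hI hz hL (fun i => F (L - Pi.single i 1))
        (fun i hi => (ih' hi).1) fun i j hi hj => by
          -- For `i ≠ j`, both sides equal the member of the family at `L - γ_i - γ_j`.
          by_cases h : i = j
          · rw [h]
          · rw [(ih' hi).2 j (by simpa [Ne.symm h] using hj),
              (ih' hj).2 i (by simpa [h] using hi), tsub_right_comm]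
      exact (hF L ⟨G, fun h => absurd h hL1, hG, hGF⟩).2
  exact ⟨F, hF1.1 rfl, fun L hL => key _ L rfl hL⟩

end Levels

end InverseSystem

theorem proposition3p5 {k : Type*} [Field k] {n d : ℕ}
    (I : Ideal (MvPowerSeries (Fin n) k)) [IsLocalRing (MvPowerSeries (Fin n) k ⧸ I)]
    (hI : InverseSystem.IsGorensteinLocalRing (MvPowerSeries (Fin n) k ⧸ I))
    (z : Fin d → MvPowerSeries (Fin n) k)
    (hz : InverseSystem.IsRegularLinearSequence I z) :
    -- compatible generators on the levels `L - γᵢ` lift to a generator on the level `L`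
    (∀ L : Fin d → ℕ, (∀ i, 1 ≤ L i) →
      ∀ H : Fin d → InverseSystem.DividedPowers n k,
        (∀ i, 2 ≤ L i →
          InverseSystem.IsGenerator (H i) (InverseSystem.W I z (L - Pi.single i 1))) →
        (∀ i j, 2 ≤ L i → 2 ≤ L j → z j • H i = z i • H j) →
        ∃ HL : InverseSystem.DividedPowers n k,
          InverseSystem.IsGenerator HL (InverseSystem.W I z L) ∧
          ∀ i, 2 ≤ L i → z i • HL = H i) ∧
    -- every generator on the level `(1, …, 1)` extends to a compatible system of generators
    (∀ H₁ : InverseSystem.DividedPowers n k,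
      InverseSystem.IsGenerator H₁ (InverseSystem.W I z 1) →
      ∃ H : (Fin d → ℕ) → InverseSystem.DividedPowers n k,
        H 1 = H₁ ∧
        ∀ L : Fin d → ℕ, (∀ i, 1 ≤ L i) →
          InverseSystem.IsGenerator (H L) (InverseSystem.W I z L) ∧
          ∀ i, 2 ≤ L i → z i • H L = H (L - Pi.single i 1)) :=
  ⟨fun _ hL H hH hcomp => InverseSystem.exists_isGenerator_lift hI hz hL H hH hcomp,
    fun _ hH₁ => InverseSystem.exists_compatible_family hI hz hH₁⟩
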